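/- Let $Y$ be Young's lattice, i.e. the set of all integer partitions (Young diagrams) ordered by inclusion of diagrams, with $\wedge$ and $\vee$ the intersection and union of diagrams, and let $\mathbb{R}^+=\{r\in\mathbb{R} : r\ge 0\}$. For $\lambda\in Y$ let $|\lambda|$ be the number of cells of $\lambda$ and $f_\lambda$ the number of standard Young tableaux of shape $\lambda$. Let $\mu: Y\to\mathbb{R}^+$ be log-supermodular, that is, $\mu(\lambda)\mu(\sigma)\le \mu(\lambda\wedge\sigma)\,\mu(\lambda\vee\sigma)$ for all $\lambda,\sigma\in Y$, and let $s,t$ be real numbers with $0\le s\le t$. For $k: Y\to\mathbb{R}^+$ define the formal power series $$F(k;z)=\sum_{\lambda\in Y} k(\lambda)\,\mu(\lambda)\,(f_\lambda)^t\,\frac{z^{|\lambda|}}{(|\lambda|!)^s}\in\mathbb{R}^+[[z]].$$ For $G,H\in\mathbb{R}[[z]]$ write $G(z)\ll H(z)$ if all coefficients of $H(z)-G(z)$ are nonnegative. Let $g,h: Y\to\mathbb{R}^+$. If $g$ and $h$ are both increasing or both decreasing (in the weak sense, with respect to the order of $Y$), then $$F(g;z)\cdot F(h;z)\ \ll\ F(1;z)\cdot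 F(gh;z).$$ If one of $g,h$ is increasing and the other is decreasing, then $$F(1;z)\cdot F(gh;z)\ \ll\ F(g;z)\cdot F(h;z).$$ -/

import Mathlib

open scoped Nat

/-- `w` satisfies `w x * w y ≤ w (x ∧ y) * w (x ∨ y)` for all `x`, `y`.
Nonnegativity of `w` is always stated separately. -/
def LogSupermodular {L : Type*} [Lattice L] (w : L → ℝ) : Prop :=
  ∀ x y : L, w x * w y ≤ w (x ⊓ y) * w (x ⊔ y)

/-- Both functions are (weakly) increasing or both are (weakly) decreasing. -/
def Comonotone {L : Type*} [Preorder L] (g h : L → ℝ) : Prop :=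
  (Monotone g ∧ Monotone h) ∨ (Antitone g ∧ Antitone h)

/-- One of the functions is (weakly) increasing and the other is (weakly) decreasing. -/
def Countermonotone {L : Type*} [Preorder L] (g h : L → ℝ) : Prop :=
  (Monotone g ∧ Antitone h) ∨ (Antitone g ∧ Monotone h)

/-- A bijective filling of the cells of `l` by `{0, …, |l| - 1}` (that is, by `{1, …, |l|}` up to
the shift by one) is a standard Young tableau if its entries strictly increase along every row
and down every column. A cell is a pair (row index, column index). -/
def IsStandardYoungTableau (l : YoungDiagram) (T : l.cells ≃ Fin l.card) : Prop :=
  (∀ c d : l.cells, c.1.1 = d.1.1 → c.1.2 < d.1.2 → T c < T d) ∧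
  (∀ c d : l.cells, c.1.2 = d.1.2 → c.1.1 < d.1.1 → T c < T d)

/-- The number `f_l` of standard Young tableaux of shape `l`. -/
noncomputable def numSYT (l : YoungDiagram) : ℕ :=
  Nat.card {T : l.cells ≃ Fin l.card // IsStandardYoungTableau l T}

/-- There are only finitely many Young diagrams with `n` cells. -/
theorem finite_youngDiagram_card_eq (n : ℕ) : {l : YoungDiagram | l.card = n}.Finite := by
  have hfin : ((Finset.range n ×ˢ Finset.range n).powerset : Set (Finset (ℕ × ℕ))).Finite :=
    Finset.finite_toSet _
  refine Set.Finite.subset (hfin.preimage (f := YoungDiagram.cells)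
    (fun a _ b _ hab => YoungDiagram.ext hab)) ?_
  intro l hl
  have hl' : l.cells.card = n := hl
  simp only [Set.mem_preimage, Finset.coe_powerset, Set.mem_powerset_iff]
  rintro ⟨i, j⟩ hc
  have hc' : (i, j) ∈ l := hc
  have h1 : ((Finset.range (i + 1)).image fun a => (a, j)) ⊆ l.cells := by
    intro x hx
    obtain ⟨a, ha, rfl⟩ := Finset.mem_image.1 hx
    exact l.up_left_mem (Nat.lt_succ_iff.1 (Finset.mem_range.1 ha)) le_rfl hc'
  have h2 : ((Finset.range (j + 1)).image fun b => (i, b)) ⊆ l.cells := by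
    intro x hx
    obtain ⟨b, hb, rfl⟩ := Finset.mem_image.1 hx
    exact l.up_left_mem le_rfl (Nat.lt_succ_iff.1 (Finset.mem_range.1 hb)) hc'
  have c1 := Finset.card_le_card h1
  have c2 := Finset.card_le_card h2
  rw [Finset.card_image_of_injective _ (fun a b hab => (Prod.mk.inj hab).1),
    Finset.card_range, hl'] at c1
  rw [Finset.card_image_of_injective _ (fun a b hab => (Prod.mk.inj hab).2),
    Finset.card_range, hl'] at c2
  simp only [Finset.coe_product, Finset.coe_range, Set.mem_prod, Set.mem_Iio]
  omega

/-- The finite set of all Young diagrams with `n` cells. -/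
noncomputable def youngDiagramsOfCard (n : ℕ) : Finset YoungDiagram :=
  (finite_youngDiagram_card_eq n).toFinset

/-- The formal power series `∑_l k(l) w(l) f_l ^ t z ^ |l| / (|l|!) ^ s`, summed over all Young
diagrams `l`; the coefficient of `z ^ n` is the sum over the finitely many `l` with `|l| = n`. -/
noncomputable def tableauSeries (w : YoungDiagram → ℝ) (s t : ℝ) (k : YoungDiagram → ℝ) :
    PowerSeries ℝ :=
  PowerSeries.mk fun n => ∑ l ∈ youngDiagramsOfCard n,
    k l * w l * (numSYT l : ℝ) ^ t / ((l.card ! : ℕ) : ℝ) ^ s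

/-- Coefficientwise inequality: `H - G` has nonnegative coefficients. -/
def CoeffLE (G H : PowerSeries ℝ) : Prop :=
  ∀ n : ℕ, 0 ≤ PowerSeries.coeff n (H - G)

/-! Write `W` for the weight $\mu(\lambda)f_\lambda^t/(|\lambda|!)^s$. Symmetrizing, twice the
coefficient of $z^n$ in $F(1)F(gh)-F(g)F(h)$ is the sum of
$W(\lambda)W(\sigma)(g(\lambda)-g(\sigma))(h(\lambda)-h(\sigma))$ over pairs with
$|\lambda|+|\sigma|=n$. Pairs with prescribed meet and join form a finite sublattice of $Y\times
Y^{op}$, on which $g(\lambda)-g(\sigma)$ and $h(\lambda)-h(\sigma)$ are increasing when $g,h$ are,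
and have weighted mean zero by the swap symmetry. FKG makes each such partial sum nonnegative
(`sum_mul_sub_mul_sub_nonneg_of_inf_sup`).

It remains to see that `W` is log-supermodular. Since $W=\mu\,(f/n!)^s f^{t-s}$ and $f=(f/n!)\,n!$
with $n!$ log-convex, the crux is $f_\lambda/|\lambda|!$. It is the limiting fraction of maps from
the cells to an $N$-set that are antitone. Counts of bounded $P$-partitions are log-supermodular at
each finite level (`ncard_boundedPartitions_mul_le`), again by FKG, and the inequality passes to the
limit. -/

/-! ### FKG and the correlation inequality for pairs. -/

section FKG

open Finset FinsetFamily

/-- The FKG inequality on a finite sublattice of a distributive lattice. -/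
theorem fkg_of_sublattice {α : Type*} [DistribLattice α] (C : Finset α)
    (hinf : ∀ a ∈ C, ∀ b ∈ C, a ⊓ b ∈ C) (hsup : ∀ a ∈ C, ∀ b ∈ C, a ⊔ b ∈ C)
    (μ f g : α → ℝ) (hμ0 : ∀ a ∈ C, 0 ≤ μ a) (hf0 : ∀ a ∈ C, 0 ≤ f a) (hg0 : ∀ a ∈ C, 0 ≤ g a)
    (hf : MonotoneOn f C) (hg : MonotoneOn g C)
    (hμ : ∀ a ∈ C, ∀ b ∈ C, μ a * μ b ≤ μ (a ⊓ b) * μ (a ⊔ b)) :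
    (∑ a ∈ C, μ a * f a) * ∑ a ∈ C, μ a * g a ≤
      (∑ a ∈ C, μ a) * ∑ a ∈ C, μ a * (f a * g a) := by
  classical
  have hnonneg : ∀ k : α → ℝ, (∀ a ∈ C, 0 ≤ k a) → 0 ≤ fun a => if a ∈ C then k a else 0 := by
    intro k hk a
    by_cases ha : a ∈ C <;> simp [ha, hk]
  have hmul : ∀ k : α → ℝ, (∀ a ∈ C, 0 ≤ k a) → ∀ a ∈ C, 0 ≤ μ a * k a :=
    fun k hk a ha => mul_nonneg (hμ0 a ha) (hk a ha)
  have hinfs : C ⊼ C ⊆ C := by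
    intro x hx
    obtain ⟨a, ha, b, hb, rfl⟩ := mem_infs.1 hx
    exact hinf a ha b hb
  have hsups : C ⊻ C ⊆ C := by
    intro x hx
    obtain ⟨a, ha, b, hb, rfl⟩ := mem_sups.1 hx
    exact hsup a ha b hb
  have hsum : ∀ k : α → ℝ, ∑ a ∈ C, (if a ∈ C then k a else 0) = ∑ a ∈ C, k a :=
    fun k => sum_congr rfl fun a ha => if_pos ha
  have h0fg : ∀ a ∈ C, 0 ≤ f a * g a := fun a ha => mul_nonneg (hf0 a ha) (hg0 a ha)
  -- Extending all four functions by zero off `C` makes the hypothesis trivial unless both points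
  -- lie in `C`.
  have key := four_functions_theorem
    (fun a => if a ∈ C then μ a * f a else 0) (fun a => if a ∈ C then μ a * g a else 0)
    (fun a => if a ∈ C then μ a else 0) (fun a => if a ∈ C then μ a * (f a * g a) else 0)
    (hnonneg _ (hmul f hf0)) (hnonneg _ (hmul g hg0)) (hnonneg _ hμ0) (hnonneg _ (hmul _ h0fg))
    (fun a b => ?_) C C
  · rw [hsum, hsum] at key
    refine key.trans ?_
    rw [← hsum μ, ← hsum fun a => μ a * (f a * g a)]
    refine mul_le_mul
      (sum_le_sum_of_subset_of_nonneg hinfs fun a _ _ => hnonneg _ hμ0 a)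
      (sum_le_sum_of_subset_of_nonneg hsups fun a _ _ => hnonneg _ (hmul _ h0fg) a)
      (sum_nonneg fun a _ => hnonneg _ (hmul _ h0fg) a) (sum_nonneg fun a _ => hnonneg _ hμ0 a)
  · by_cases ha : a ∈ C
    · by_cases hb : b ∈ C
      · have hi := hinf a ha b hb
        have hs := hsup a ha b hb
        simp only [ha, hb, hi, hs, if_true]
        calc μ a * f a * (μ b * g b) = μ a * μ b * (f a * g b) := by ring
          _ ≤ μ (a ⊓ b) * μ (a ⊔ b) * (f (a ⊔ b) * g (a ⊔ b)) :=
            mul_le_mul (hμ a ha b hb)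
              (mul_le_mul (hf ha hs le_sup_left) (hg hb hs le_sup_right) (hg0 b hb) (hf0 _ hs))
              (mul_nonneg (hf0 a ha) (hg0 b hb)) (mul_nonneg (hμ0 _ hi) (hμ0 _ hs))
          _ = _ := by ring
      · simp only [hb, if_false, mul_zero]
        exact mul_nonneg (hnonneg _ hμ0 _) (hnonneg _ (hmul _ h0fg) _)
    · simp only [ha, if_false, zero_mul]
      exact mul_nonneg (hnonneg _ hμ0 _) (hnonneg _ (hmul _ h0fg) _)

/-- The pairs with given meet and join form a sublattice of `L × Lᵒᵈ`; the FKG inequality on it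
gives a correlation inequality for the differences of the two components. -/
theorem sum_mul_sub_mul_sub_nonneg_of_inf_sup {L : Type*} [DistribLattice L] (w g h : L → ℝ)
    (hw0 : ∀ x, 0 ≤ w x) (hw : LogSupermodular w) (hg : Monotone g) (hh : Monotone h) (a b : L)
    (C : Finset (L × L)) (hC : ∀ p, p ∈ C ↔ p.1 ⊓ p.2 = a ∧ p.1 ⊔ p.2 = b) :
    0 ≤ ∑ p ∈ C, w p.1 * w p.2 * ((g p.1 - g p.2) * (h p.1 - h p.2)) := by
  classical
  -- Reversing the second factor makes `g x - g y` increasing; the meet of two pairs becomes `(x ⊓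
  -- x', y ⊔ y')`. Distributivity keeps this pair in the same meet-join class.
  let e : L × L ≃ L × Lᵒᵈ := Equiv.prodCongr (Equiv.refl L) OrderDual.toDual
  have hmeet : ∀ x y x' y' : L, x ⊓ y = a → x' ⊓ y' = a → (x ⊓ x') ⊓ (y ⊔ y') = a := by
    intro x y x' y' h1 h2
    rw [inf_sup_left]
    have e1 : x ⊓ x' ⊓ y = a ⊓ x' := by rw [← h1, inf_right_comm]
    have e2 : x ⊓ x' ⊓ y' = x ⊓ a := by rw [← h2, inf_assoc]
    rw [e1, e2]
    have hx : a ≤ x := h1 ▸ inf_le_left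
    have hx' : a ≤ x' := h2 ▸ inf_le_left
    rw [inf_eq_left.2 hx', inf_eq_right.2 hx, sup_idem]
  have hjoin : ∀ x y x' y' : L, x ⊔ y = b → x' ⊔ y' = b → (x ⊓ x') ⊔ (y ⊔ y') = b := by
    intro x y x' y' h1 h2
    rw [sup_inf_right]
    have e1 : x ⊔ (y ⊔ y') = b ⊔ y' := by rw [← h1, sup_assoc]
    have e2 : x' ⊔ (y ⊔ y') = y ⊔ b := by rw [← h2, sup_left_comm]
    rw [e1, e2]
    have hy : y ≤ b := h1 ▸ le_sup_right
    have hy' : y' ≤ b := h2 ▸ le_sup_right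
    rw [sup_eq_left.2 hy', sup_eq_right.2 hy, inf_idem]
  have hmem : ∀ q, q ∈ C.map e.toEmbedding ↔ (q.1, OrderDual.ofDual q.2) ∈ C := by
    intro q
    rw [Finset.mem_map_equiv]
    rfl
  have hswap : ∀ p, p ∈ C → p.swap ∈ C := by
    intro p hp
    rw [hC] at hp ⊢
    exact ⟨by simpa [inf_comm] using hp.1, by simpa [sup_comm] using hp.2⟩
  have hanti : ∀ k : L → ℝ, ∑ p ∈ C, w p.1 * w p.2 * (k p.1 - k p.2) = 0 := by
    intro k
    have h1 : ∑ p ∈ C, w p.1 * w p.2 * (k p.1 - k p.2) =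
        ∑ p ∈ C, w p.2 * w p.1 * (k p.2 - k p.1) :=
      Finset.sum_bij' (fun p _ => p.swap) (fun p _ => p.swap) (fun p hp => hswap p hp)
        (fun p hp => hswap p hp) (fun _ _ => rfl) (fun _ _ => rfl) (fun _ _ => rfl)
    have h2 : ∑ p ∈ C, w p.2 * w p.1 * (k p.2 - k p.1) =
        -∑ p ∈ C, w p.1 * w p.2 * (k p.1 - k p.2) := by
      rw [← Finset.sum_neg_distrib]
      exact Finset.sum_congr rfl fun p _ => by ring
    linarith
  -- `fkg_of_sublattice` needs nonnegative functions. As `a ≤ p.1` and `p.2 ≤ b`, the shift `k b - k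
  -- a` suffices, and a constant shift does not change the covariance.
  have hbd : ∀ k : L → ℝ, Monotone k → ∀ p ∈ C, 0 ≤ k p.1 - k p.2 + (k b - k a) := by
    intro k hk p hp
    obtain ⟨h1, h2⟩ := (hC p).1 hp
    have := hk (h1 ▸ inf_le_left : a ≤ p.1)
    have := hk (h2 ▸ le_sup_right : p.2 ≤ b)
    linarith
  have hmono : ∀ k : L → ℝ, Monotone k → ∀ s : Set (L × Lᵒᵈ),
      MonotoneOn (fun q : L × Lᵒᵈ => k q.1 - k (OrderDual.ofDual q.2) + (k b - k a)) s := by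
    intro k hk s p _ q _ hpq
    have h1 := hk hpq.1
    have h2 := hk (show OrderDual.ofDual q.2 ≤ OrderDual.ofDual p.2 from hpq.2)
    simp only
    linarith
  have key := fkg_of_sublattice (C.map e.toEmbedding)
    (fun p hp q hq => by
      rw [hmem] at hp hq ⊢
      rw [hC] at hp hq ⊢
      exact ⟨hmeet _ _ _ _ hp.1 hq.1, hjoin _ _ _ _ hp.2 hq.2⟩)
    (fun p hp q hq => by
      rw [hmem] at hp hq ⊢
      rw [hC] at hp hq ⊢
      refine ⟨?_, ?_⟩
      · rw [inf_comm]
        exact hmeet _ _ _ _ ((inf_comm _ _).trans hp.1) ((inf_comm _ _).trans hq.1)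
      · rw [sup_comm]
        exact hjoin _ _ _ _ ((sup_comm _ _).trans hp.2) ((sup_comm _ _).trans hq.2))
    (fun q => w q.1 * w (OrderDual.ofDual q.2))
    (fun q => g q.1 - g (OrderDual.ofDual q.2) + (g b - g a))
    (fun q => h q.1 - h (OrderDual.ofDual q.2) + (h b - h a))
    (fun q _ => mul_nonneg (hw0 _) (hw0 _))
    (fun q hq => hbd g hg _ ((hmem q).1 hq)) (fun q hq => hbd h hh _ ((hmem q).1 hq))
    (hmono g hg _) (hmono h hh _)
    (fun p _ q _ => by
      have h1 := hw p.1 q.1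
      have h2 := hw (OrderDual.ofDual p.2) (OrderDual.ofDual q.2)
      calc w p.1 * w (OrderDual.ofDual p.2) * (w q.1 * w (OrderDual.ofDual q.2))
          = w p.1 * w q.1 * (w (OrderDual.ofDual p.2) * w (OrderDual.ofDual q.2)) := by ring
        _ ≤ w (p.1 ⊓ q.1) * w (p.1 ⊔ q.1) * (w (OrderDual.ofDual p.2 ⊓ OrderDual.ofDual q.2) *
              w (OrderDual.ofDual p.2 ⊔ OrderDual.ofDual q.2)) :=
            mul_le_mul h1 h2 (mul_nonneg (hw0 _) (hw0 _)) (mul_nonneg (hw0 _) (hw0 _))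
        _ = w (p.1 ⊓ q.1) * w (OrderDual.ofDual p.2 ⊔ OrderDual.ofDual q.2) *
              (w (p.1 ⊔ q.1) * w (OrderDual.ofDual p.2 ⊓ OrderDual.ofDual q.2)) := by ring)
  simp only [Finset.sum_map] at key
  change (∑ p ∈ C, w p.1 * w p.2 * (g p.1 - g p.2 + (g b - g a))) *
    (∑ p ∈ C, w p.1 * w p.2 * (h p.1 - h p.2 + (h b - h a))) ≤
    (∑ p ∈ C, w p.1 * w p.2) * ∑ p ∈ C, w p.1 * w p.2 *
      ((g p.1 - g p.2 + (g b - g a)) * (h p.1 - h p.2 + (h b - h a))) at key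
  have hshift : ∀ (k : L → ℝ) (c : ℝ), ∑ p ∈ C, w p.1 * w p.2 * (k p.1 - k p.2 + c) =
      (∑ p ∈ C, w p.1 * w p.2) * c := by
    intro k c
    simp only [mul_add, Finset.sum_add_distrib, hanti k, zero_add, Finset.sum_mul]
  have hprod : ∑ p ∈ C, w p.1 * w p.2 *
      ((g p.1 - g p.2 + (g b - g a)) * (h p.1 - h p.2 + (h b - h a))) =
      (∑ p ∈ C, w p.1 * w p.2 * ((g p.1 - g p.2) * (h p.1 - h p.2))) +
      (∑ p ∈ C, w p.1 * w p.2) * ((g b - g a) * (h b - h a)) := by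
    have hG := hanti g
    have hH := hanti h
    calc _ = (∑ p ∈ C, w p.1 * w p.2 * ((g p.1 - g p.2) * (h p.1 - h p.2))) +
          (∑ p ∈ C, w p.1 * w p.2 * (g p.1 - g p.2)) * (h b - h a) +
          (∑ p ∈ C, w p.1 * w p.2 * (h p.1 - h p.2)) * (g b - g a) +
          (∑ p ∈ C, w p.1 * w p.2) * ((g b - g a) * (h b - h a)) := by
          simp only [Finset.sum_mul, ← Finset.sum_add_distrib]
          exact Finset.sum_congr rfl fun p _ => by ring
      _ = _ := by rw [hG, hH]; ring
  -- With `S` the total weight and `X` the target sum, `key` reduces to `0 ≤ S * X`. If `S = 0`,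
  -- every weight vanishes.
  rw [hshift, hshift, hprod] at key
  have hS : 0 ≤ ∑ p ∈ C, w p.1 * w p.2 := Finset.sum_nonneg fun p _ => mul_nonneg (hw0 _) (hw0 _)
  rcases hS.eq_or_lt with h0 | hpos
  · have hz := (Finset.sum_eq_zero_iff_of_nonneg
      (fun p _ => mul_nonneg (hw0 p.1) (hw0 p.2))).1 h0.symm
    exact (Finset.sum_eq_zero fun p hp => by rw [hz p hp, zero_mul]).ge
  · refine nonneg_of_mul_nonneg_right ?_ hpos
    nlinarith [key]

/-- Summing over all pairs of given total rank with respect to a modular rank function. -/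
theorem sum_mul_sub_mul_sub_nonneg_of_rank {L : Type*} [DistribLattice L] (w g h : L → ℝ)
    (hw0 : ∀ x, 0 ≤ w x) (hw : LogSupermodular w) (hg : Monotone g) (hh : Monotone h)
    (r : L → ℕ) (hr : ∀ x y, r (x ⊓ y) + r (x ⊔ y) = r x + r y) (n : ℕ)
    (S : Finset (L × L)) (hS : ∀ p, p ∈ S ↔ r p.1 + r p.2 = n) :
    0 ≤ ∑ p ∈ S, w p.1 * w p.2 * ((g p.1 - g p.2) * (h p.1 - h p.2)) := by
  classical
  rw [← Finset.sum_fiberwise_of_maps_to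
    (t := S.image fun p => (p.1 ⊓ p.2, p.1 ⊔ p.2)) (fun p hp => Finset.mem_image_of_mem _ hp)]
  refine Finset.sum_nonneg fun q hq => ?_
  obtain ⟨p, hp, rfl⟩ := Finset.mem_image.1 hq
  refine sum_mul_sub_mul_sub_nonneg_of_inf_sup w g h hw0 hw hg hh (p.1 ⊓ p.2) (p.1 ⊔ p.2) _ ?_
  intro q
  rw [Finset.mem_filter, Prod.mk.injEq, and_iff_right_iff_imp]
  rintro ⟨h1, h2⟩
  rw [hS] at hp ⊢
  -- Modularity makes the total rank depend only on meet and join, so `S` contains entire meet-join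
  -- classes.
  rw [← hr, h1, h2, hr, hp]

end FKG

/-! ### Coefficients of products as sums over pairs of diagrams. -/

section Series

theorem mem_youngDiagramsOfCard {n : ℕ} {l : YoungDiagram} :
    l ∈ youngDiagramsOfCard n ↔ l.card = n := by
  simp [youngDiagramsOfCard]

theorem YoungDiagram.card_inf_add_card_sup (x y : YoungDiagram) :
    (x ⊓ y).card + (x ⊔ y).card = x.card + y.card :=
  Finset.card_inter_add_card_union _ _

theorem pairwiseDisjoint_youngDiagramsOfCard_product (s : Set (ℕ × ℕ)) :
    s.PairwiseDisjoint fun q => youngDiagramsOfCard q.1 ×ˢ youngDiagramsOfCard q.2 := by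
  intro a _ b _ hab
  refine Finset.disjoint_left.2 fun p hp hp' => hab ?_
  simp only [Finset.mem_product, mem_youngDiagramsOfCard] at hp hp'
  exact Prod.ext (hp.1.symm.trans hp'.1) (hp.2.symm.trans hp'.2)

/-- The pairs of Young diagrams with `n` cells in total. -/
noncomputable def youngPairsOfCard (n : ℕ) : Finset (YoungDiagram × YoungDiagram) :=
  (Finset.HasAntidiagonal.antidiagonal n).disjiUnion
    (fun q => youngDiagramsOfCard q.1 ×ˢ youngDiagramsOfCard q.2)
    (pairwiseDisjoint_youngDiagramsOfCard_product _)

theorem mem_youngPairsOfCard {n : ℕ} {p : YoungDiagram × YoungDiagram} :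
    p ∈ youngPairsOfCard n ↔ p.1.card + p.2.card = n := by
  simp [youngPairsOfCard, mem_youngDiagramsOfCard]

/-- The weight of a Young diagram in the tableau series. -/
noncomputable def tableauWeight (w : YoungDiagram → ℝ) (s t : ℝ) (l : YoungDiagram) : ℝ :=
  w l * (numSYT l : ℝ) ^ t / ((l.card ! : ℕ) : ℝ) ^ s

theorem coeff_tableauSeries_mul (w : YoungDiagram → ℝ) (s t : ℝ) (g h : YoungDiagram → ℝ) (n : ℕ) :
    PowerSeries.coeff n (tableauSeries w s t g * tableauSeries w s t h) =
      ∑ p ∈ youngPairsOfCard n,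
        tableauWeight w s t p.1 * tableauWeight w s t p.2 * (g p.1 * h p.2) := by
  rw [PowerSeries.coeff_mul, youngPairsOfCard, Finset.sum_disjiUnion]
  refine Finset.sum_congr rfl fun q _ => ?_
  rw [tableauSeries, tableauSeries, PowerSeries.coeff_mk, PowerSeries.coeff_mk,
    Finset.sum_mul_sum, Finset.sum_product]
  refine Finset.sum_congr rfl fun x _ => Finset.sum_congr rfl fun y _ => ?_
  simp only [tableauWeight]
  ring

theorem two_mul_coeff_tableauSeries_sub (w : YoungDiagram → ℝ) (s t : ℝ)
    (g h : YoungDiagram → ℝ) (n : ℕ) :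
    2 * PowerSeries.coeff n (tableauSeries w s t 1 * tableauSeries w s t (g * h) -
        tableauSeries w s t g * tableauSeries w s t h) =
      ∑ p ∈ youngPairsOfCard n, tableauWeight w s t p.1 * tableauWeight w s t p.2 *
        ((g p.1 - g p.2) * (h p.1 - h p.2)) := by
  rw [map_sub, coeff_tableauSeries_mul, coeff_tableauSeries_mul, ← Finset.sum_sub_distrib, two_mul]
  have hswap : ∑ p ∈ youngPairsOfCard n,
        (tableauWeight w s t p.1 * tableauWeight w s t p.2 *
            ((1 : YoungDiagram → ℝ) p.1 * (g * h) p.2) -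
          tableauWeight w s t p.1 * tableauWeight w s t p.2 * (g p.1 * h p.2)) =
      ∑ p ∈ youngPairsOfCard n,
        (tableauWeight w s t p.2 * tableauWeight w s t p.1 *
            ((1 : YoungDiagram → ℝ) p.2 * (g * h) p.1) -
          tableauWeight w s t p.2 * tableauWeight w s t p.1 * (g p.2 * h p.1)) := by
    have hmem : ∀ p ∈ youngPairsOfCard n, p.swap ∈ youngPairsOfCard n := by
      intro p hp
      rw [mem_youngPairsOfCard] at hp ⊢
      rw [← hp]
      exact Nat.add_comm _ _
    exact Finset.sum_bij' (fun p _ => p.swap) (fun p _ => p.swap) hmem hmem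
      (fun _ _ => rfl) (fun _ _ => rfl) (fun _ _ => rfl)
  -- Only one of the two copies is swapped; adding the copies then gives the factored form.
  conv_lhs => enter [2]; rw [hswap]
  rw [← Finset.sum_add_distrib]
  refine Finset.sum_congr rfl fun p _ => ?_
  simp only [Pi.one_apply, Pi.mul_apply]
  ring

end Series
-- Log-supermodularity of bounded `P`-partition counts.
section BoundedPartitions

/-- The `P`-partitions with values at most `N` that vanish off `I`. -/
def boundedPartitions {P : Type*} [PartialOrder P] (I : Finset P) (N : ℕ) : Set (P → Fin (N + 1)) :=
  {f | Antitone f ∧ ∀ x ∉ I, f x = 0}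

variable {P : Type*} [PartialOrder P]

theorem finite_boundedPartitions (I : Finset P) (N : ℕ) : (boundedPartitions I N).Finite := by
  refine Set.Finite.of_finite_image (f := fun f (x : I) => f x) (Set.toFinite _) ?_
  intro f hf f' hf' h
  funext x
  by_cases hx : x ∈ I
  · exact congrFun h ⟨x, hx⟩
  · rw [hf.2 x hx, hf'.2 x hx]

theorem boundedPartitions_mono {I J : Finset P} (hIJ : I ⊆ J) (N : ℕ) :
    boundedPartitions I N ⊆ boundedPartitions J N :=
  fun _ hf => ⟨hf.1, fun x hx => hf.2 x fun h => hx (hIJ h)⟩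

theorem inf_mem_boundedPartitions {I : Finset P} {N : ℕ} {f g : P → Fin (N + 1)}
    (hf : f ∈ boundedPartitions I N) (hg : g ∈ boundedPartitions I N) :
    f ⊓ g ∈ boundedPartitions I N :=
  ⟨hf.1.inf hg.1, fun x hx => by rw [Pi.inf_apply, hf.2 x hx, hg.2 x hx, inf_idem]⟩

theorem sup_mem_boundedPartitions {I : Finset P} {N : ℕ} {f g : P → Fin (N + 1)}
    (hf : f ∈ boundedPartitions I N) (hg : g ∈ boundedPartitions I N) :
    f ⊔ g ∈ boundedPartitions I N :=
  ⟨hf.1.sup hg.1, fun x hx => by rw [Pi.sup_apply, hf.2 x hx, hg.2 x hx, sup_idem]⟩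

variable [DecidableEq P]

/-- The function agreeing with `f` on `K` and vanishing off `K`. -/
def restrictZero {N : ℕ} (K : Finset P) (f : P → Fin (N + 1)) : P → Fin (N + 1) :=
  fun x => if x ∈ K then f x else 0

theorem restrictZero_mem {I K : Finset P} (hK : IsLowerSet (K : Set P)) {N : ℕ}
    {f : P → Fin (N + 1)} (hf : f ∈ boundedPartitions I N) :
    restrictZero K f ∈ boundedPartitions K N := by
  refine ⟨fun x y hxy => ?_, fun x hx => if_neg hx⟩
  by_cases hy : y ∈ K
  · have hx : x ∈ K := hK hxy hy
    simpa [restrictZero, hx, hy] using hf.1 hxy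
  · simp [restrictZero, hy]

/-- The extensions of `u` from `K` to `I`. -/
noncomputable def extensionsOf (I K : Finset P) (N : ℕ) (u : P → Fin (N + 1)) :
    Finset (P → Fin (N + 1)) :=
  by classical exact (finite_boundedPartitions I N).toFinset.filter fun f => restrictZero K f = u

theorem mem_extensionsOf {I K : Finset P} {N : ℕ} {u f : P → Fin (N + 1)} :
    f ∈ extensionsOf I K N u ↔ f ∈ boundedPartitions I N ∧ restrictZero K f = u := by
  simp [extensionsOf]

theorem sum_card_extensionsOf {I K : Finset P} (hK : IsLowerSet (K : Set P)) (N : ℕ) :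
    ∑ u ∈ (finite_boundedPartitions K N).toFinset, (extensionsOf I K N u).card =
      (finite_boundedPartitions I N).toFinset.card := by
  classical
  rw [Finset.card_eq_sum_card_fiberwise (f := restrictZero K)
    (t := (finite_boundedPartitions K N).toFinset)]
  · refine Finset.sum_congr rfl fun u _ => congrArg Finset.card ?_
    ext f
    simp [mem_extensionsOf]
  · intro f hf
    simp only [Set.Finite.coe_toFinset] at hf ⊢
    exact restrictZero_mem hK hf

/-- Joining with `v` overwrites an extension of `u` only on `K`, where its values were prescribed
anyway, so the map is injective. -/
theorem card_extensionsOf_mono {I K : Finset P} (hKI : K ⊆ I) {N : ℕ}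
    {u v : P → Fin (N + 1)} (hv : v ∈ boundedPartitions K N) (huv : u ≤ v) :
    (extensionsOf I K N u).card ≤ (extensionsOf I K N v).card := by
  have hval : ∀ f ∈ extensionsOf I K N u, ∀ x, (x ∈ K → (f ⊔ v) x = v x) ∧
      (x ∉ K → (f ⊔ v) x = f x) := by
    intro f hf x
    rw [mem_extensionsOf] at hf
    constructor
    · intro hx
      have h := congrFun hf.2 x
      rw [restrictZero, if_pos hx] at h
      rw [Pi.sup_apply, h]
      exact sup_eq_right.2 (huv x)
    · intro hx
      rw [Pi.sup_apply, hv.2 x hx]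
      exact sup_eq_left.2 (Fin.zero_le _)
  refine Finset.card_le_card_of_injOn (fun f => f ⊔ v) ?_ ?_
  · intro f hf
    have hf' := mem_extensionsOf.1 hf
    refine mem_extensionsOf.2
      ⟨sup_mem_boundedPartitions hf'.1 (boundedPartitions_mono hKI N hv), ?_⟩
    funext x
    by_cases hx : x ∈ K
    · rw [restrictZero, if_pos hx]
      exact (hval f hf x).1 hx
    · rw [restrictZero, if_neg hx, hv.2 x hx]
  · intro f hf f' hf' h
    funext x
    by_cases hx : x ∈ K
    · have h1 := congrFun (mem_extensionsOf.1 hf).2 x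
      have h2 := congrFun (mem_extensionsOf.1 hf').2 x
      rw [restrictZero, if_pos hx] at h1 h2
      rw [h1, h2]
    · rw [← (hval f hf x).2 hx, ← (hval f' hf' x).2 hx]
      exact congrFun h x

/-- Gluing: the two extensions agree on `I ∩ J` and each vanishes off its own set, so their join
restricts to each of them and determines both. -/
theorem card_extensionsOf_mul_le {I J : Finset P} {N : ℕ} (u : P → Fin (N + 1)) :
    (extensionsOf I (I ∩ J) N u).card * (extensionsOf J (I ∩ J) N u).card ≤
      (extensionsOf (I ∪ J) (I ∩ J) N u).card := by
  have hval : ∀ f ∈ extensionsOf I (I ∩ J) N u, ∀ f' ∈ extensionsOf J (I ∩ J) N u, ∀ x,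
      (x ∈ I → (f ⊔ f') x = f x) ∧ (x ∈ J → (f ⊔ f') x = f' x) := by
    intro f hf f' hf' x
    rw [mem_extensionsOf] at hf hf'
    by_cases hxI : x ∈ I <;> by_cases hxJ : x ∈ J
    · have hx : x ∈ I ∩ J := Finset.mem_inter.2 ⟨hxI, hxJ⟩
      have h1 := congrFun hf.2 x
      have h2 := congrFun hf'.2 x
      rw [restrictZero, if_pos hx] at h1 h2
      simp [h1, h2]
    · have h2 := hf'.1.2 x hxJ
      simp [h2, hxJ]
    · have h1 := hf.1.2 x hxI
      simp [h1, hxI]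
    · simp [hxI, hxJ]
  rw [← Finset.card_product]
  refine Finset.card_le_card_of_injOn (fun p => p.1 ⊔ p.2) ?_ ?_
  · rintro ⟨f, f'⟩ hp
    obtain ⟨hf, hf'⟩ := Finset.mem_product.1 hp
    have hf1 := mem_extensionsOf.1 hf
    have hf2 := mem_extensionsOf.1 hf'
    refine mem_extensionsOf.2 ⟨sup_mem_boundedPartitions
      (boundedPartitions_mono Finset.subset_union_left N hf1.1)
      (boundedPartitions_mono Finset.subset_union_right N hf2.1), ?_⟩
    rw [← hf1.2]
    funext x
    by_cases hx : x ∈ I ∩ J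
    · simp only [restrictZero, if_pos hx]
      exact (hval f hf f' hf' x).1 (Finset.mem_inter.1 hx).1
    · simp only [restrictZero, if_neg hx]
  · rintro ⟨f, f'⟩ hp ⟨k, k'⟩ hq h
    obtain ⟨hf, hf'⟩ := Finset.mem_product.1 hp
    obtain ⟨hk, hk'⟩ := Finset.mem_product.1 hq
    have h' : f ⊔ f' = k ⊔ k' := h
    refine Prod.ext (funext fun x => ?_) (funext fun x => ?_)
    · by_cases hx : x ∈ I
      · exact ((hval f hf f' hf' x).1 hx).symm.trans
          ((congrFun h' x).trans ((hval k hk k' hk' x).1 hx))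
      · exact ((mem_extensionsOf.1 hf).1.2 x hx).trans ((mem_extensionsOf.1 hk).1.2 x hx).symm
    · by_cases hx : x ∈ J
      · exact ((hval f hf f' hf' x).2 hx).symm.trans
          ((congrFun h' x).trans ((hval k hk k' hk' x).2 hx))
      · exact ((mem_extensionsOf.1 hf').1.2 x hx).trans ((mem_extensionsOf.1 hk').1.2 x hx).symm

/-- The number of bounded `P`-partitions on a lower set is log-supermodular. -/
theorem ncard_boundedPartitions_mul_le {I J : Finset P} (hI : IsLowerSet (I : Set P))
    (hJ : IsLowerSet (J : Set P)) (N : ℕ) :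
    ((boundedPartitions I N).ncard : ℝ) * (boundedPartitions J N).ncard ≤
      (boundedPartitions (I ∩ J) N).ncard * (boundedPartitions (I ∪ J) N).ncard := by
  have hK : IsLowerSet ((I ∩ J : Finset P) : Set P) := by
    rw [Finset.coe_inter]
    exact hI.inter hJ
  -- For a uniformly chosen partition on `I ∩ J`, the numbers of extensions to `I` and to `J` are
  -- increasing, hence positively correlated.
  have key := fkg_of_sublattice (finite_boundedPartitions (I ∩ J) N).toFinset
    (fun f hf g hg => by
      rw [Set.Finite.mem_toFinset] at hf hg ⊢
      exact inf_mem_boundedPartitions hf hg)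
    (fun f hf g hg => by
      rw [Set.Finite.mem_toFinset] at hf hg ⊢
      exact sup_mem_boundedPartitions hf hg)
    (fun _ => 1) (fun u => ((extensionsOf I (I ∩ J) N u).card : ℝ))
    (fun u => ((extensionsOf J (I ∩ J) N u).card : ℝ))
    (fun _ _ => zero_le_one) (fun _ _ => Nat.cast_nonneg _) (fun _ _ => Nat.cast_nonneg _)
    (fun u _ v hv huv => Nat.cast_le.2
      (card_extensionsOf_mono Finset.inter_subset_left (by simpa using hv) huv))
    (fun u _ v hv huv => Nat.cast_le.2
      (card_extensionsOf_mono Finset.inter_subset_right (by simpa using hv) huv))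
    (fun _ _ _ _ => le_rfl)
  simp only [one_mul, Finset.sum_const, nsmul_eq_mul, mul_one] at key
  have hc : ∀ K : Finset P, (boundedPartitions K N).ncard =
      (finite_boundedPartitions K N).toFinset.card :=
    fun K => Set.ncard_eq_toFinset_card _ _
  rw [← Nat.cast_sum, ← Nat.cast_sum, sum_card_extensionsOf hK, sum_card_extensionsOf hK,
    ← hc, ← hc, ← hc] at key
  refine key.trans (mul_le_mul_of_nonneg_left ?_ (Nat.cast_nonneg _))
  rw [hc (I ∪ J), ← sum_card_extensionsOf hK, Nat.cast_sum]
  exact Finset.sum_le_sum fun u _ => by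
    rw [← Nat.cast_mul]
    exact Nat.cast_le.2 (card_extensionsOf_mul_le u)

end BoundedPartitions

/-! ### Linear extensions as a limit of antitone counts. -/

section Asymptotics

open Filter Topology

variable {Q : Type*} [Fintype Q] [PartialOrder Q]

/-- An injective antitone labelling is an antitone bijection onto an initial segment, followed by
the increasing enumeration of its range. -/
theorem card_injective_antitone (N : ℕ) :
    Nat.card {f : Q → Fin N // Function.Injective f ∧ Antitone f} =
      Nat.card {T : Q ≃ Fin (Fintype.card Q) // Antitone T} * N.choose (Fintype.card Q) := by
  classical
  have hS : Nat.card (Finset.powersetCard (Fintype.card Q) (Finset.univ : Finset (Fin N))) =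
      N.choose (Fintype.card Q) := by
    rw [Nat.card_eq_fintype_card, Fintype.card_coe, Finset.card_powersetCard, Finset.card_fin]
  rw [← hS, ← Nat.card_prod]
  have hcard : ∀ S : Finset.powersetCard (Fintype.card Q) (Finset.univ : Finset (Fin N)),
      S.1.card = Fintype.card Q := fun S => (Finset.mem_powersetCard.1 S.2).2
  let F : {T : Q ≃ Fin (Fintype.card Q) // Antitone T} ×
      Finset.powersetCard (Fintype.card Q) (Finset.univ : Finset (Fin N)) →
      {f : Q → Fin N // Function.Injective f ∧ Antitone f} := fun p =>
    ⟨fun q => p.2.1.orderEmbOfFin (hcard p.2) (p.1.1 q),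
      (p.2.1.orderEmbOfFin (hcard p.2)).injective.comp p.1.1.injective,
      (p.2.1.orderEmbOfFin (hcard p.2)).monotone.comp_antitone p.1.2⟩
  refine (Nat.card_eq_of_bijective F ⟨?_, ?_⟩).symm
  · rintro ⟨⟨T, hT⟩, S⟩ ⟨⟨T', hT'⟩, S'⟩ h
    have hfun : ∀ q, S.1.orderEmbOfFin (hcard S) (T q) = S'.1.orderEmbOfFin (hcard S') (T' q) :=
      fun q => congrFun (congrArg Subtype.val h) q
    have hSS : S = S' := by
      refine Subtype.ext (Finset.coe_injective ?_)
      rw [← Finset.range_orderEmbOfFin S.1 (hcard S), ← Finset.range_orderEmbOfFin S'.1 (hcard S'),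
        ← T.surjective.range_comp, ← T'.surjective.range_comp]
      exact congrArg Set.range (funext hfun)
    subst hSS
    have hTT : T = T' := Equiv.ext fun q => (S.1.orderEmbOfFin (hcard S)).injective (hfun q)
    subst hTT
    rfl
  · rintro ⟨f, hf, hanti⟩
    have hSc : (Finset.univ.image f).card = Fintype.card Q :=
      Finset.card_image_of_injective _ hf
    have hmem : ∀ q, f q ∈ Finset.univ.image f :=
      fun q => Finset.mem_image_of_mem f (Finset.mem_univ q)
    let T : Q → Fin (Fintype.card Q) :=
      fun q => ((Finset.univ.image f).orderIsoOfFin hSc).symm ⟨f q, hmem q⟩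
    have hTf : ∀ q, (Finset.univ.image f).orderEmbOfFin hSc (T q) = f q := by
      intro q
      rw [← Finset.coe_orderIsoOfFin_apply, OrderIso.apply_symm_apply]
    have hTinj : Function.Injective T := fun q q' h => hf (by rw [← hTf, ← hTf, h])
    have hTbij : Function.Bijective T :=
      (Fintype.bijective_iff_injective_and_card T).2 ⟨hTinj, (Fintype.card_fin _).symm⟩
    refine ⟨(⟨Equiv.ofBijective T hTbij, fun q q' h => ?_⟩,
      ⟨Finset.univ.image f, Finset.mem_powersetCard.2 ⟨Finset.subset_univ _, hSc⟩⟩), ?_⟩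
    · exact ((Finset.univ.image f).orderIsoOfFin hSc).symm.monotone (hanti h)
    · exact Subtype.ext (funext hTf)

/-- Inclusion-exclusion for the antitone and the injective maps inside all `N ^ |Q|` maps. -/
theorem card_antitone_le (N : ℕ) :
    Nat.card {f : Q → Fin N // Antitone f} + N.descFactorial (Fintype.card Q) ≤
      Nat.card {f : Q → Fin N // Function.Injective f ∧ Antitone f} + N ^ Fintype.card Q := by
  classical
  have h1 : N.descFactorial (Fintype.card Q) =
      (Finset.univ.filter fun f : Q → Fin N => Function.Injective f).card := by
    rw [← Fintype.card_subtype, Fintype.card_congr (Equiv.subtypeInjectiveEquivEmbedding Q (Fin N)),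
      Fintype.card_embedding_eq, Fintype.card_fin]
  have h2 : N ^ Fintype.card Q = (Finset.univ : Finset (Q → Fin N)).card := by simp
  rw [h1, h2, Nat.card_eq_fintype_card, Nat.card_eq_fintype_card, Fintype.card_subtype,
    Fintype.card_subtype, ← Finset.card_union_add_card_inter, ← Finset.filter_and, add_comm]
  simp only [and_comm]
  exact Nat.add_le_add_left (Finset.card_le_univ _) _

/-- For large `N` almost every map is injective, so the antitone fraction is squeezed between the
injective antitone fraction and that plus the fraction of non-injective maps. -/
theorem tendsto_card_antitone_div :
    Tendsto (fun N : ℕ => (Nat.card {f : Q → Fin N // Antitone f} : ℝ) / (N : ℝ) ^ Fintype.card Q)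
      atTop (𝓝 ((Nat.card {T : Q ≃ Fin (Fintype.card Q) // Antitone T} : ℝ) /
        ((Fintype.card Q)! : ℕ))) := by
  classical
  set n := Fintype.card Q
  set e : ℝ := (Nat.card {T : Q ≃ Fin n // Antitone T} : ℝ)
  have hd : Tendsto (fun N : ℕ => (N.descFactorial n : ℝ) / (N : ℝ) ^ n) atTop (𝓝 1) := by
    refine (Asymptotics.isEquivalent_iff_tendsto_one ?_).1 (isEquivalent_descFactorial n)
    filter_upwards [eventually_gt_atTop 0] with N hN
    positivity
  have hchoose : ∀ N : ℕ, (N.choose n : ℝ) = N.descFactorial n / (n ! : ℕ) := by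
    intro N
    rw [Nat.descFactorial_eq_factorial_mul_choose, Nat.cast_mul]
    field_simp
  have hlow : Tendsto (fun N : ℕ => e / (n ! : ℕ) * ((N.descFactorial n : ℝ) / (N : ℝ) ^ n)) atTop
      (𝓝 (e / (n ! : ℕ))) := by simpa using hd.const_mul (e / (n ! : ℕ))
  have hup : Tendsto (fun N : ℕ => e / (n ! : ℕ) * ((N.descFactorial n : ℝ) / (N : ℝ) ^ n) +
      (1 - (N.descFactorial n : ℝ) / (N : ℝ) ^ n)) atTop (𝓝 (e / (n ! : ℕ))) := by
    simpa using hlow.add (hd.const_sub 1)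
  refine tendsto_of_tendsto_of_tendsto_of_le_of_le' hlow hup ?_ ?_
  · filter_upwards [eventually_gt_atTop 0] with N hN
    have hle : (Nat.card {f : Q → Fin N // Function.Injective f ∧ Antitone f} : ℝ) ≤
        Nat.card {f : Q → Fin N // Antitone f} :=
      Nat.cast_le.2 (Nat.card_le_card_of_injective
        (fun f => (⟨f.1, f.2.2⟩ : {f : Q → Fin N // Antitone f}))
        fun f f' h => Subtype.ext (Subtype.mk.inj h))
    rw [card_injective_antitone, Nat.cast_mul, hchoose] at hle
    calc e / (n ! : ℕ) * ((N.descFactorial n : ℝ) / (N : ℝ) ^ n)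
        = e * (N.descFactorial n / (n ! : ℕ)) / (N : ℝ) ^ n := by ring
      _ ≤ _ := by gcongr
  · filter_upwards [eventually_gt_atTop 0] with N hN
    have hle : (Nat.card {f : Q → Fin N // Antitone f} : ℝ) + N.descFactorial n ≤
        Nat.card {f : Q → Fin N // Function.Injective f ∧ Antitone f} + (N : ℝ) ^ n := by
      exact_mod_cast card_antitone_le (Q := Q) N
    rw [card_injective_antitone, Nat.cast_mul, hchoose] at hle
    have hpos : (0 : ℝ) < (N : ℝ) ^ n := by positivity
    rw [div_le_iff₀ hpos]
    have : (e / (n ! : ℕ) * ((N.descFactorial n : ℝ) / (N : ℝ) ^ n) +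
        (1 - (N.descFactorial n : ℝ) / (N : ℝ) ^ n)) * (N : ℝ) ^ n =
        e * (N.descFactorial n / (n ! : ℕ)) + ((N : ℝ) ^ n - N.descFactorial n) := by
      field_simp
    rw [this]
    linarith

end Asymptotics
-- Passage to the limit on finite lower sets.
section LinearExtensions

open Filter Topology

theorem ncard_boundedPartitions {P : Type*} [PartialOrder P] [DecidableEq P] {I : Finset P}
    (hI : IsLowerSet (I : Set P)) (N : ℕ) :
    (boundedPartitions I N).ncard = Nat.card {f : I → Fin (N + 1) // Antitone f} := by
  rw [← Nat.card_coe_set_eq]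
  refine Nat.card_eq_of_bijective
    (fun f => ⟨fun x => f.1 x, fun x y hxy => f.2.1 hxy⟩) ⟨?_, ?_⟩
  · intro f f' h
    refine Subtype.ext (funext fun x => ?_)
    by_cases hx : x ∈ I
    · exact congrFun (congrArg Subtype.val h) ⟨x, hx⟩
    · rw [f.2.2 x hx, f'.2.2 x hx]
  · rintro ⟨f, hf⟩
    refine ⟨⟨fun x => if hx : x ∈ I then f ⟨x, hx⟩ else 0, fun x y hxy => ?_,
      fun x hx => dif_neg hx⟩, ?_⟩
    · by_cases hy : y ∈ I
      · have hx : x ∈ I := hI hxy hy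
        simp only [hx, hy, dif_pos]
        exact hf hxy
      · simp [hy]
    · refine Subtype.ext (funext fun x => ?_)
      simp

/-- The number of linear extensions divided by the factorial of the size is log-supermodular on
the lattice of finite lower sets. -/
theorem card_antitone_equiv_div_mul_le {P : Type*} [PartialOrder P] [DecidableEq P]
    {I J : Finset P} (hI : IsLowerSet (I : Set P)) (hJ : IsLowerSet (J : Set P))
    (e : Finset P → ℝ)
    (he : ∀ K, e K = (Nat.card {T : K ≃ Fin (Fintype.card K) // Antitone T} : ℝ) /
      ((Fintype.card K)! : ℕ)) :
    e I * e J ≤ e (I ∩ J) * e (I ∪ J) := by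
  have hlim : ∀ K : Finset P, IsLowerSet (K : Set P) →
      Tendsto (fun N : ℕ => ((boundedPartitions K N).ncard : ℝ) / ((N + 1 : ℕ) : ℝ) ^ K.card)
        atTop (𝓝 (e K)) := by
    intro K hK
    have h := (tendsto_add_atTop_iff_nat 1).2 (tendsto_card_antitone_div (Q := K))
    rw [he]
    refine h.congr fun N => ?_
    rw [ncard_boundedPartitions hK, Fintype.card_coe]
  have hinter : IsLowerSet ((I ∩ J : Finset P) : Set P) := by
    rw [Finset.coe_inter]
    exact hI.inter hJ
  have hunion : IsLowerSet ((I ∪ J : Finset P) : Set P) := by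
    rw [Finset.coe_union]
    exact hI.union hJ
  refine le_of_tendsto_of_tendsto' ((hlim I hI).mul (hlim J hJ))
    ((hlim _ hinter).mul (hlim _ hunion)) fun N => ?_
  -- Cardinality is modular, so both sides carry the same power of `N + 1`.
  rw [div_mul_div_comm, div_mul_div_comm, ← pow_add, ← pow_add, Finset.card_inter_add_card_union]
  exact div_le_div_of_nonneg_right (ncard_boundedPartitions_mul_le hI hJ N) (by positivity)

end LinearExtensions

/-! ### Log-supermodularity of the tableau weight. -/

section Tableaux

theorem isStandardYoungTableau_iff_monotone (l : YoungDiagram) (T : l.cells ≃ Fin l.card) :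
    IsStandardYoungTableau l T ↔ Monotone T := by
  constructor
  · rintro ⟨hrow, hcol⟩ ⟨⟨i, j⟩, hc⟩ ⟨⟨i', j'⟩, hd⟩ hle
    obtain ⟨hi, hj⟩ : i ≤ i' ∧ j ≤ j' := hle
    -- The corner `(i, j')` splits the comparison into a row step and a column step.
    have hm : (i, j') ∈ l.cells := l.up_left_mem hi le_rfl hd
    have h1 : T ⟨(i, j), hc⟩ ≤ T ⟨(i, j'), hm⟩ := by
      rcases hj.eq_or_lt with rfl | hlt
      · exact le_rfl
      · exact (hrow ⟨(i, j), hc⟩ ⟨(i, j'), hm⟩ rfl hlt).le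
    have h2 : T ⟨(i, j'), hm⟩ ≤ T ⟨(i', j'), hd⟩ := by
      rcases hi.eq_or_lt with rfl | hlt
      · exact le_rfl
      · exact (hcol ⟨(i, j'), hm⟩ ⟨(i', j'), hd⟩ rfl hlt).le
    exact h1.trans h2
  · intro hT
    have hlt : ∀ c d : l.cells, c.1 < d.1 → T c < T d :=
      fun c d h => hT.strictMono_of_injective T.injective h
    exact ⟨fun c d h1 h2 => hlt c d (Prod.lt_iff.2 (Or.inr ⟨h1.le, h2⟩)),
      fun c d h1 h2 => hlt c d (Prod.lt_iff.2 (Or.inl ⟨h2, h1.le⟩))⟩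

/-- Replacing each entry by its complement turns increasing fillings into decreasing ones. -/
theorem numSYT_eq_card_antitone (l : YoungDiagram) :
    numSYT l = Nat.card {T : l.cells ≃ Fin (Fintype.card l.cells) // Antitone T} := by
  have hcard : l.card = Fintype.card l.cells := (Fintype.card_coe _).symm
  refine Nat.card_congr (Equiv.subtypeEquiv
    (Equiv.equivCongr (Equiv.refl _) ((finCongr hcard).trans Fin.revPerm)) fun T => ?_)
  rw [isStandardYoungTableau_iff_monotone]
  constructor
  · intro hT x y hxy
    exact Fin.rev_le_rev.2 (Fin.cast_le_cast hcard |>.2 (hT hxy))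
  · intro hT x y hxy
    exact (Fin.cast_le_cast hcard).1 (Fin.rev_le_rev.1 (hT hxy))

theorem logSupermodular_numSYT_div_factorial :
    LogSupermodular fun l : YoungDiagram => (numSYT l : ℝ) / (l.card ! : ℕ) := by
  intro x y
  have hcard : ∀ l : YoungDiagram, Fintype.card l.cells = l.card := fun l => Fintype.card_coe _
  have key := card_antitone_equiv_div_mul_le x.isLowerSet y.isLowerSet _ fun K => rfl
  rw [← YoungDiagram.cells_inf, ← YoungDiagram.cells_sup] at key
  simp only [← numSYT_eq_card_antitone, hcard] at key
  exact key

/-- With `n = a + k` and `b = m + k`, compare the `k` factors above `a` with the `k` factors above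
`m`, term by term. -/
theorem Nat.factorial_mul_factorial_le_of_add_eq {a b m n : ℕ} (han : a ≤ n) (ham : a ≤ m)
    (h : a + b = n + m) : n ! * m ! ≤ a ! * b ! := by
  obtain ⟨k, rfl⟩ := Nat.exists_eq_add_of_le han
  obtain rfl : b = m + k := by omega
  rw [← Nat.factorial_mul_ascFactorial, ← Nat.factorial_mul_ascFactorial]
  have h2 : (a + 1).ascFactorial k ≤ (m + 1).ascFactorial k := by
    induction k with
    | zero => simp
    | succ k ih =>
      rw [Nat.ascFactorial_succ, Nat.ascFactorial_succ]
      exact Nat.mul_le_mul (by omega) (ih (by omega) (by omega))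
  calc a ! * (a + 1).ascFactorial k * m ! ≤ a ! * (m + 1).ascFactorial k * m ! := by gcongr
    _ = a ! * (m ! * (m + 1).ascFactorial k) := by ring

theorem logSupermodular_factorial_card :
    LogSupermodular fun l : YoungDiagram => ((l.card ! : ℕ) : ℝ) := by
  intro x y
  have h : x.card ! * y.card ! ≤ (x ⊓ y).card ! * (x ⊔ y).card ! :=
    Nat.factorial_mul_factorial_le_of_add_eq
      (Finset.card_le_card (YoungDiagram.cells_subset_iff.2 (inf_le_left : x ⊓ y ≤ x)))
      (Finset.card_le_card (YoungDiagram.cells_subset_iff.2 (inf_le_right : x ⊓ y ≤ y)))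
      (YoungDiagram.card_inf_add_card_sup x y)
  simp only
  exact_mod_cast h

theorem LogSupermodular.mul {L : Type*} [Lattice L] {v w : L → ℝ} (hv : LogSupermodular v)
    (hw : LogSupermodular w) (hv0 : ∀ x, 0 ≤ v x) (hw0 : ∀ x, 0 ≤ w x) :
    LogSupermodular fun x => v x * w x := by
  intro x y
  calc v x * w x * (v y * w y) = v x * v y * (w x * w y) := by ring
    _ ≤ v (x ⊓ y) * v (x ⊔ y) * (w (x ⊓ y) * w (x ⊔ y)) :=
      mul_le_mul (hv x y) (hw x y) (mul_nonneg (hw0 _) (hw0 _)) (mul_nonneg (hv0 _) (hv0 _))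
    _ = _ := by ring

theorem LogSupermodular.rpow {L : Type*} [Lattice L] {w : L → ℝ} (hw : LogSupermodular w)
    (hw0 : ∀ x, 0 ≤ w x) {r : ℝ} (hr : 0 ≤ r) : LogSupermodular fun x => w x ^ r := by
  intro x y
  simp only
  rw [← Real.mul_rpow (hw0 _) (hw0 _), ← Real.mul_rpow (hw0 _) (hw0 _)]
  exact Real.rpow_le_rpow (mul_nonneg (hw0 _) (hw0 _)) (hw x y) hr

theorem logSupermodular_numSYT : LogSupermodular fun l : YoungDiagram => (numSYT l : ℝ) := by
  have h := logSupermodular_numSYT_div_factorial.mul logSupermodular_factorial_card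
    (fun _ => by positivity) (fun _ => by positivity)
  refine (congrArg LogSupermodular (funext fun l => ?_)).mp h
  exact div_mul_cancel₀ _ (by positivity)

theorem tableauWeight_nonneg {w : YoungDiagram → ℝ} (hw0 : ∀ l, 0 ≤ w l) (s t : ℝ)
    (l : YoungDiagram) : 0 ≤ tableauWeight w s t l :=
  div_nonneg (mul_nonneg (hw0 l) (by positivity)) (by positivity)

theorem logSupermodular_tableauWeight {w : YoungDiagram → ℝ} (hw0 : ∀ l, 0 ≤ w l)
    (hw : LogSupermodular w) {s t : ℝ} (hs : 0 ≤ s) (hst : s ≤ t) :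
    LogSupermodular (tableauWeight w s t) := by
  have h := hw.mul ((logSupermodular_numSYT_div_factorial.rpow (fun _ => by positivity) hs).mul
    (logSupermodular_numSYT.rpow (fun _ => by positivity) (sub_nonneg.2 hst))
    (fun _ => by positivity) (fun _ => by positivity)) hw0 (fun _ => by positivity)
  refine (congrArg LogSupermodular (funext fun l => ?_)).mp h
  -- Both exponents are nonnegative, so the split does not require `numSYT l ≠ 0`.
  have h1 : (numSYT l : ℝ) ^ t = (numSYT l : ℝ) ^ s * (numSYT l : ℝ) ^ (t - s) := by
    rw [← Real.rpow_add_of_nonneg (by positivity) hs (sub_nonneg.2 hst), add_sub_cancel]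
  rw [tableauWeight, Real.div_rpow (by positivity) (by positivity), h1]
  ring

end Tableaux

/-! ### Assembly of the theorem. -/

theorem theorem6p3 (μ : YoungDiagram → ℝ) (hμ0 : ∀ l, 0 ≤ μ l) (hμ : LogSupermodular μ)
    (s t : ℝ) (hs : 0 ≤ s) (hst : s ≤ t)
    (g h : YoungDiagram → ℝ) (hg0 : ∀ l, 0 ≤ g l) (hh0 : ∀ l, 0 ≤ h l) :
    (Comonotone g h →
      CoeffLE (tableauSeries μ s t g * tableauSeries μ s t h)
        (tableauSeries μ s t 1 * tableauSeries μ s t (g * h))) ∧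
    (Countermonotone g h →
      CoeffLE (tableauSeries μ s t 1 * tableauSeries μ s t (g * h))
        (tableauSeries μ s t g * tableauSeries μ s t h)) := by
  have main : ∀ (g h : YoungDiagram → ℝ), Monotone g → Monotone h → ∀ n,
      0 ≤ ∑ p ∈ youngPairsOfCard n, tableauWeight μ s t p.1 * tableauWeight μ s t p.2 *
        ((g p.1 - g p.2) * (h p.1 - h p.2)) := fun g h hg hh n =>
    sum_mul_sub_mul_sub_nonneg_of_rank _ g h (tableauWeight_nonneg hμ0 s t)
      (logSupermodular_tableauWeight hμ0 hμ hs hst) hg hh YoungDiagram.card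
      YoungDiagram.card_inf_add_card_sup n _ fun _ => mem_youngPairsOfCard
  constructor
  · intro hgh n
    have h2 := two_mul_coeff_tableauSeries_sub μ s t g h n
    rcases hgh with ⟨hg, hh⟩ | ⟨hg, hh⟩
    · linarith [main g h hg hh n]
    -- `main` imposes no sign condition, so decreasing functions may be negated; two negations
    -- cancel in the product, while a single one reverses the inequality.
    · have h3 := main (-g) (-h) hg.neg hh.neg n
      have h4 : ∀ p : YoungDiagram × YoungDiagram,
          ((-g) p.1 - (-g) p.2) * ((-h) p.1 - (-h) p.2) = (g p.1 - g p.2) * (h p.1 - h p.2) :=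
        fun p => by simp only [Pi.neg_apply]; ring
      simp only [h4] at h3
      linarith
  · intro hgh n
    have h2 := two_mul_coeff_tableauSeries_sub μ s t g h n
    rw [map_sub] at h2 ⊢
    rcases hgh with ⟨hg, hh⟩ | ⟨hg, hh⟩
    · have h3 := main g (-h) hg hh.neg n
      have h4 : ∀ p : YoungDiagram × YoungDiagram,
          (g p.1 - g p.2) * ((-h) p.1 - (-h) p.2) = -((g p.1 - g p.2) * (h p.1 - h p.2)) :=
        fun p => by simp only [Pi.neg_apply]; ring
      simp only [h4, mul_neg, Finset.sum_neg_distrib] at h3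
      linarith
    · have h3 := main (-g) h hg.neg hh n
      have h4 : ∀ p : YoungDiagram × YoungDiagram,
          ((-g) p.1 - (-g) p.2) * (h p.1 - h p.2) = -((g p.1 - g p.2) * (h p.1 - h p.2)) :=
        fun p => by simp only [Pi.neg_apply]; ring
      simp only [h4, mul_neg, Finset.sum_neg_distrib] at h3
      linarith
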